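/- Let $p$ be a prime, $L=\mathbb F_{p^m}$, and let $\sigma\colon x\mapsto x^{p^k}$, $\tau\colon x\mapsto x^{p^l}$ be field automorphisms of $L$ with integers $0\le k,l<m/2$ and $k\neq l$; write $\overline\tau=\tau^{-1}$. For $\alpha,\eta\in L$ let $\mathcal S_{\sigma,\tau,\alpha,\eta}$ denote $L^2$ with its usual addition and the multiplication $$\begin{pmatrix}x_0\\x_1\end{pmatrix}\circ\begin{pmatrix}y_0\\y_1\end{pmatrix}=\begin{pmatrix}x_1y_1^{\sigma}-\eta x_1^{\sigma}y_1+\alpha\,(x_0y_0^{\sigma}-\eta x_0^{\sigma}y_0)\\ x_0^{\tau}y_1+x_1y_0^{\tau}\end{pmatrix},$$ and let $\mathcal S'_{\sigma,\tau,\alpha,\eta}$ denote $L^2$ with the multiplication $$\begin{pmatrix}x_0\\x_1\end{pmatrix}\circ'\begin{pmatrix}y_0\\y_1\end{pmatrix}=\begin{pmatrix}x_1y_1^{\sigma}-\eta x_1^{\sigma}y_1+\alpha\,(x_0y_0^{\sigma}-\eta^{\overline\tau} x_0^{\sigma}y_0)\\ x_0^{\tau}y_1+x_1y_0^{\tau}\end{pmatrix}.$$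 A finite additive group with a multiplication that is distributive on both sides and has no zero divisors is called a (pre-)semifield. Two (pre-)semifields $(\mathbb F_p^n,+,\circ_1)$ and $(\mathbb F_p^n,+,\circ_2)$ are isotopic if there are $\mathbb F_p$-linear bijections $N_1,N_2,N_3$ with $N_1(x\circ_1y)=N_2(x)\circ_2N_3(y)$ for all $x,y$. Let $\alpha_1,\eta_1,\alpha_2,\eta_2\in L$. 1. If $\mathcal S_{\sigma,\tau,\alpha_1,\eta_1}$ and $\mathcal S_{\tau,\sigma,\alpha_2,\eta_2}$ are (pre-)semifields, then they are not isotopic. 2. If $\mathcal S'_{\sigma,\tau,\alpha_1,\eta_1}$ and $\mathcal S'_{\tau,\sigma,\alpha_2,\eta_2}$ are (pre-)semifields, then they are not isotopic. -/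

import Mathlib

/-- A binary operation on an additive commutative group `E` makes it a pre-semifield if it is
left and right distributive over `+` and has no zero divisors. -/
structure IsPresemifield {E : Type*} [AddCommGroup E] (mul : E → E → E) : Prop where
  finite : Finite E
  left_distrib : ∀ x y z, mul x (y + z) = mul x y + mul x z
  right_distrib : ∀ x y z, mul (x + y) z = mul x z + mul y z
  eq_zero_or_eq_zero : ∀ x y, mul x y = 0 → x = 0 ∨ y = 0

/-- Two multiplications on `𝔽_p`-vector spaces are isotopic if there are `𝔽_p`-linear bijections
`N₁, N₂, N₃` with `N₁ (x ∘₁ y) = N₂ x ∘₂ N₃ y`. -/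
def Isotopic (p : ℕ) {E F : Type*} [AddCommGroup E] [Module (ZMod p) E]
    [AddCommGroup F] [Module (ZMod p) F] (mul₁ : E → E → E) (mul₂ : F → F → F) : Prop :=
  ∃ N₁ N₂ N₃ : E ≃ₗ[ZMod p] F, ∀ x y, N₁ (mul₁ x y) = mul₂ (N₂ x) (N₃ y)

/-- The multiplication of `S_{σ,τ,α,η}` on `L²`, the vector `(x₀, x₁)` being the pair `x`:
`(x₁ y₁^σ - η x₁^σ y₁ + α (x₀ y₀^σ - η x₀^σ y₀), x₀^τ y₁ + x₁ y₀^τ)`. -/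
def mulS {p : ℕ} {L : Type*} [Field L] [Algebra (ZMod p) L] (σ τ : L ≃ₐ[ZMod p] L) (α η : L)
    (x y : L × L) : L × L :=
  (x.2 * σ y.2 - η * σ x.2 * y.2 + α * (x.1 * σ y.1 - η * σ x.1 * y.1),
    τ x.1 * y.2 + x.2 * τ y.1)

/-- The multiplication obtained from the one on `L²` with first component
`x₁ y₁^σ - η x₁^σ y₁ + α (x₀ y₀^σ - η x₀^σ y₀)^{τ⁻¹}` and second component `x₀ y₁ + x₁ y₀`
by replacing `x₀, y₀` by `x₀^τ, y₀^τ`: the second `η` becomes `η^{τ⁻¹}`. -/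
def mulS' {p : ℕ} {L : Type*} [Field L] [Algebra (ZMod p) L] (σ τ : L ≃ₐ[ZMod p] L) (α η : L)
    (x y : L × L) : L × L :=
  (x.2 * σ y.2 - η * σ x.2 * y.2 + α * (x.1 * σ y.1 - τ.symm η * σ x.1 * y.1),
    τ x.1 * y.2 + x.2 * τ y.1)

/-!
If `L/K` is Galois, every `K`-linear map `L² → L` is a unique `L`-linear combination of the
functions `x ↦ g x₀` and `x ↦ g x₁` with `g` in the Galois group, so a bilinear map `L² × L² → L` is
a matrix indexed by these functions. Let `f (x ∘ y) = p x ∘ q y`, where the roles of `σ` and `τ` are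
exchanged in the second multiplication. The second component of the right-hand side is a sum of two
products of a linear form in `x` and a linear form in `y`, so its matrix has rank at most two. For
the left-hand side this matrix is sparse, and rank at most two forces the second component of `f` to
be a monomial in one of the two variables; the matrix then has exactly two nonzero entries. This
confines both components of `p` and of `q` to two coefficients up to twisting, and comparing the
entries of the first component of the equation in columns where most terms vanish shows that a
determinant of these coefficients is zero, although the rank is exactly two.
-/

section Coordinates

variable {K L : Type*} [Field K] [Field L] [Algebra K L]

/-- The `K`-linear coordinate functions on `L²`: `inl g` stands for `x ↦ g x₀` and `inr g` for
`x ↦ g x₁`. If `L/K` is Galois, they form an `L`-basis of the `K`-linear maps `L² → L`. -/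
def coord : Gal(L/K) ⊕ Gal(L/K) → (L × L →ₗ[K] L)
  | .inl g => g.toLinearMap ∘ₗ LinearMap.fst K L L
  | .inr g => g.toLinearMap ∘ₗ LinearMap.snd K L L

@[simp]
theorem coord_inl_apply (g : Gal(L/K)) (x : L × L) : coord (.inl g) x = g x.1 := rfl

@[simp]
theorem coord_inr_apply (g : Gal(L/K)) (x : L × L) : coord (.inr g) x = g x.2 := rfl

theorem apply_coord (g : Gal(L/K)) (i : Gal(L/K) ⊕ Gal(L/K)) (x : L × L) :
    g (coord i x) = coord (g • i) x := by
  cases i <;> rfl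

/-- The coefficient vector of `g ∘ f`, where `v` is the coefficient vector of `f : L² → L` with
respect to `coord`. -/
def twist (g : Gal(L/K)) (v : Gal(L/K) ⊕ Gal(L/K) → L) (i : Gal(L/K) ⊕ Gal(L/K)) : L :=
  g (v (g⁻¹ • i))

@[simp]
theorem twist_smul (g : Gal(L/K)) (v : Gal(L/K) ⊕ Gal(L/K) → L) (i : Gal(L/K) ⊕ Gal(L/K)) :
    twist g v (g • i) = g (v i) := by
  rw [twist, inv_smul_smul]

@[simp]
theorem twist_one (v : Gal(L/K) ⊕ Gal(L/K) → L) : twist 1 v = v := by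
  funext i
  simp [twist]

variable [FiniteDimensional K L]

theorem linearIndependent_coord :
    LinearIndependent L (coord : Gal(L/K) ⊕ Gal(L/K) → (L × L →ₗ[K] L)) := by
  have hGal : LinearIndependent L fun g : Gal(L/K) => g.toLinearMap :=
    (linearIndependent_toLinearMap K L L).comp (fun g : Gal(L/K) => (g : L →ₐ[K] L))
      AlgEquiv.coe_toAlgHom_injective
  rw [Fintype.linearIndependent_iff] at hGal ⊢
  intro v hv
  rw [Fintype.sum_sum_type] at hv
  rintro (g | g)
  · refine hGal (v ∘ .inl) (LinearMap.ext fun x => ?_) g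
    simpa using LinearMap.congr_fun hv (x, 0)
  · refine hGal (v ∘ .inr) (LinearMap.ext fun x => ?_) g
    simpa using LinearMap.congr_fun hv (0, x)

/-- The `K`-linear form on `L²` with coefficient vector `v` with respect to `coord`. -/
noncomputable def linearForm : (Gal(L/K) ⊕ Gal(L/K) → L) →ₗ[L] (L × L →ₗ[K] L) :=
  Fintype.linearCombination L coord

theorem linearForm_apply (v : Gal(L/K) ⊕ Gal(L/K) → L) (x : L × L) :
    linearForm v x = ∑ i, v i * coord i x := by
  simp [linearForm, Fintype.linearCombination_apply]

theorem linearForm_injective : Function.Injective (linearForm (K := K) (L := L)) :=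
  linearIndependent_iff_injective_fintypeLinearCombination.mp linearIndependent_coord

theorem linearForm_surjective [IsGalois K L] :
    Function.Surjective (linearForm (K := K) (L := L)) := by
  have hcard : Module.finrank L (Gal(L/K) ⊕ Gal(L/K) → L) = Module.finrank L (L × L →ₗ[K] L) := by
    rw [Module.finrank_linearMap_self, Module.finrank_prod, Module.finrank_fintype_fun_eq_card,
      Fintype.card_sum, ← Nat.card_eq_fintype_card, IsGalois.card_aut_eq_finrank]
  exact (LinearMap.injective_iff_surjective_of_finrank_eq_finrank hcard).mp linearForm_injective

theorem linearForm_twist (g : Gal(L/K)) (v : Gal(L/K) ⊕ Gal(L/K) → L) (x : L × L) :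
    linearForm (twist g v) x = g (linearForm v x) := by
  simp_rw [linearForm_apply, map_sum, map_mul, apply_coord]
  exact Fintype.sum_equiv (MulAction.toPerm g⁻¹) _ _ fun i => by simp [twist]

/-- The `K`-bilinear form on `L²` with coefficient matrix `M` with respect to `coord`. -/
noncomputable def bilinearForm (M : Gal(L/K) ⊕ Gal(L/K) → Gal(L/K) ⊕ Gal(L/K) → L)
    (x y : L × L) : L :=
  linearForm (fun i => linearForm (M i) y) x

theorem bilinearForm_apply (M : Gal(L/K) ⊕ Gal(L/K) → Gal(L/K) ⊕ Gal(L/K) → L) (x y : L × L) :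
    bilinearForm M x y = ∑ i, ∑ j, M i j * coord j y * coord i x := by
  simp_rw [bilinearForm, linearForm_apply, Finset.sum_mul]

theorem bilinearForm_injective : Function.Injective (bilinearForm (K := K) (L := L)) := by
  intro M N h
  funext i
  refine linearForm_injective (LinearMap.ext fun y => ?_)
  have hrows : (fun i => linearForm (M i) y) = fun i => linearForm (N i) y :=
    linearForm_injective (LinearMap.ext fun x => congr_fun (congr_fun h x) y)
  exact congr_fun hrows i

end Coordinates

section RankTwo

/-- The matrices of rank at most two, written as a sum of two matrices of rank at most one. -/
def RankLETwo {R ι κ : Type*} [CommRing R] (M : ι → κ → R) : Prop :=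
  ∃ (p : ι → R) (q : κ → R) (p' : ι → R) (q' : κ → R), ∀ i j, M i j = p i * q j + p' i * q' j

theorem RankLETwo.ne_zero_or_ne_zero {R ι κ : Type*} [CommRing R] [IsDomain R] {M : ι → κ → R}
    (hM : RankLETwo M) {r₁ r₂ i : ι} {s₁ s₂ j : κ} (h₁₂ : M r₁ s₂ = 0) (h₂₁ : M r₂ s₁ = 0)
    (h₁₁ : M r₁ s₁ ≠ 0) (h₂₂ : M r₂ s₂ ≠ 0) (hij : M i j ≠ 0) :
    M i s₁ ≠ 0 ∧ M r₁ j ≠ 0 ∨ M i s₂ ≠ 0 ∧ M r₂ j ≠ 0 := by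
  obtain ⟨p, q, p', q', hM⟩ := hM
  have minor_eq_zero : M r₁ s₁ * (M r₂ s₂ * M i j - M r₂ j * M i s₂)
      - M r₁ s₂ * (M r₂ s₁ * M i j - M r₂ j * M i s₁)
      + M r₁ j * (M r₂ s₁ * M i s₂ - M r₂ s₂ * M i s₁) = 0 := by
    simp only [hM]
    ring
  contrapose! hij
  have h₁ : M i s₁ * M r₁ j = 0 := mul_eq_zero.mpr (or_iff_not_imp_left.mpr hij.1)
  have h₂ : M i s₂ * M r₂ j = 0 := mul_eq_zero.mpr (or_iff_not_imp_left.mpr hij.2)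
  refine (mul_eq_zero.mp ?_).resolve_left (mul_ne_zero h₁₁ h₂₂)
  linear_combination minor_eq_zero + (M r₂ s₁ * M i j - M r₂ j * M i s₁) * h₁₂
    - M r₁ j * M i s₂ * h₂₁ + M r₂ s₂ * h₁ + M r₁ s₁ * h₂

theorem eq_zero_of_det_ne_zero {R : Type*} [CommRing R] [IsDomain R] {x y p q p' q' : R}
    (hdet : p * q' - q * p' ≠ 0) (h₁ : x * p + y * p' = 0) (h₂ : x * q + y * q' = 0) :
    x = 0 ∧ y = 0 := by
  constructor
  · exact (mul_eq_zero.mp (by linear_combination q' * h₁ - p' * h₂ :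
      x * (p * q' - q * p') = 0)).resolve_right hdet
  · exact (mul_eq_zero.mp (by linear_combination p * h₂ - q * h₁ :
      y * (p * q' - q * p') = 0)).resolve_right hdet

variable {F ι κ : Type*} [Field F]

/-- The matrix `M` has exactly two nonzero entries, at `(r₁, s₁)` and `(r₂, s₂)`, and these lie in
different rows and in different columns. -/
structure IsTwoPoint (M : ι → κ → F) (r₁ r₂ : ι) (s₁ s₂ : κ) : Prop where
  row_ne : r₁ ≠ r₂
  col_ne : s₁ ≠ s₂
  ne_zero₁ : M r₁ s₁ ≠ 0
  ne_zero₂ : M r₂ s₂ ≠ 0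
  eq_zero : ∀ i j, ¬ (i = r₁ ∧ j = s₁) → ¬ (i = r₂ ∧ j = s₂) → M i j = 0

namespace IsTwoPoint

variable {M : ι → κ → F} {r₁ r₂ : ι} {s₁ s₂ : κ} (h : IsTwoPoint M r₁ r₂ s₁ s₂)
include h

theorem transpose : IsTwoPoint (fun j i => M i j) s₁ s₂ r₁ r₂ :=
  ⟨h.col_ne, h.row_ne, h.ne_zero₁, h.ne_zero₂, fun j i h₁ h₂ =>
    h.eq_zero i j (mt And.symm h₁) (mt And.symm h₂)⟩

variable {p p' : ι → F} {q q' : κ → F} (hM : ∀ i j, M i j = p i * q j + p' i * q' j)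
include hM

theorem col_det_ne_zero : q s₁ * q' s₂ - q s₂ * q' s₁ ≠ 0 := by
  intro hdet
  have h₁₂ := h.eq_zero r₁ s₂ (fun e => h.col_ne e.2.symm) (fun e => h.row_ne e.1)
  have h₂₁ := h.eq_zero r₂ s₁ (fun e => h.row_ne e.1.symm) (fun e => h.col_ne e.2)
  refine mul_ne_zero h.ne_zero₁ h.ne_zero₂ ?_
  rw [hM] at h₁₂ ⊢
  rw [hM] at h₂₁ ⊢
  linear_combination (p r₁ * p' r₂ - p' r₁ * p r₂) * hdet + (p r₂ * q s₁ + p' r₂ * q' s₁) * h₁₂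

theorem row_eq_zero {i : ι} (h₁ : i ≠ r₁) (h₂ : i ≠ r₂) : p i = 0 ∧ p' i = 0 := by
  refine eq_zero_of_det_ne_zero (h.col_det_ne_zero hM) ?_ ?_ <;> rw [← hM]
  · exact h.eq_zero _ _ (fun e => h₁ e.1) (fun e => h₂ e.1)
  · exact h.eq_zero _ _ (fun e => h₁ e.1) (fun e => h₂ e.1)

theorem row_det_ne_zero : p r₁ * p' r₂ - p r₂ * p' r₁ ≠ 0 :=
  h.transpose.col_det_ne_zero (p := q) (p' := q') fun j i => by rw [hM]; ring

theorem col_eq_zero {j : κ} (h₁ : j ≠ s₁) (h₂ : j ≠ s₂) : q j = 0 ∧ q' j = 0 :=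
  h.transpose.row_eq_zero (q := p) (q' := p') (fun j i => by rw [hM]; ring) h₁ h₂

end IsTwoPoint

end RankTwo

section TwistedMul

variable {K L : Type*} [Field K] [Field L] [Algebra K L]

/-- The multiplication on `L²` with which `mulS` and `mulS'` are treated simultaneously. -/
def twistedMul (σ τ : Gal(L/K)) (a b c d : L) (x y : L × L) : L × L :=
  (a * (x.2 * σ y.2) + b * (σ x.2 * y.2) + (c * (x.1 * σ y.1) + d * (σ x.1 * y.1)),
    τ x.1 * y.2 + x.2 * τ y.1)

open Classical in
/-- The coefficient matrix with respect to `coord` of the bilinear form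
`(x, y) ↦ f (twistedMul σ τ a b c d x y)`, where `f` has the coefficient vector `v`. -/
noncomputable def mulCoeff (σ τ : Gal(L/K)) (a b c d : L) (v : Gal(L/K) ⊕ Gal(L/K) → L) :
    Gal(L/K) ⊕ Gal(L/K) → Gal(L/K) ⊕ Gal(L/K) → L
  | .inl g, .inl h =>
    (if h = σ * g then v (.inl g) * g c else 0) + if g = σ * h then v (.inl h) * h d else 0
  | .inr g, .inr h =>
    (if h = σ * g then v (.inl g) * g a else 0) + if g = σ * h then v (.inl h) * h b else 0
  | .inl g, .inr h => if g = τ * h then v (.inr h) else 0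
  | .inr g, .inl h => if h = τ * g then v (.inr g) else 0

theorem bilinearForm_mulCoeff [FiniteDimensional K L] [IsMulCommutative Gal(L/K)]
    (σ τ : Gal(L/K)) (a b c d : L) (v : Gal(L/K) ⊕ Gal(L/K) → L) (x y : L × L) :
    bilinearForm (mulCoeff σ τ a b c d v) x y = linearForm v (twistedMul σ τ a b c d x y) := by
  classical
  have hcomm (g h : Gal(L/K)) (z : L) : g (h z) = h (g z) := by
    rw [← AlgEquiv.mul_apply, mul_comm', AlgEquiv.mul_apply]
  have hsum (s : Gal(L/K)) (f : Gal(L/K) → Gal(L/K) → L) :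
      ∑ g, ∑ h, (if g = s * h then f g h else 0) = ∑ h, f (s * h) h := by
    rw [Finset.sum_comm]
    simp only [Finset.sum_ite_eq', Finset.mem_univ, if_true]
  simp only [bilinearForm_apply, linearForm_apply, Fintype.sum_sum_type, mulCoeff,
    coord_inl_apply, coord_inr_apply, add_mul, ite_mul, zero_mul, Finset.sum_add_distrib, hsum,
    Finset.sum_ite_eq', Finset.mem_univ, if_true, AlgEquiv.mul_apply, twistedMul,
    map_add, map_mul, mul_add, hcomm _ σ, hcomm _ τ]
  simp only [← Finset.sum_add_distrib]
  exact Finset.sum_congr rfl fun g _ => by ring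

end TwistedMul

section Classification

/-- The properties that distinguish a pair of powers `φ ^ k`, `φ ^ l` of a Frobenius automorphism
with `k ≠ l` both smaller than half the order of `φ`. -/
structure IsGenericPair {G : Type*} [Group G] (σ τ : G) : Prop where
  ne : σ ≠ τ
  mul_ne_one : σ * τ ≠ 1
  left_eq_one : σ * σ = 1 → σ = 1
  right_eq_one : τ * τ = 1 → τ = 1

variable {K L : Type*} [Field K] [Field L] [Algebra K L] {σ τ : Gal(L/K)} {a b c d : L}
  {v : Gal(L/K) ⊕ Gal(L/K) → L} {g h : Gal(L/K)}

theorem mulCoeff_inl_inr_ne_zero :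
    mulCoeff σ τ a b c d v (.inl g) (.inr h) ≠ 0 ↔ g = τ * h ∧ v (.inr h) ≠ 0 := by
  simp [mulCoeff]

theorem mulCoeff_inr_inl_ne_zero :
    mulCoeff σ τ a b c d v (.inr g) (.inl h) ≠ 0 ↔ h = τ * g ∧ v (.inr g) ≠ 0 := by
  simp [mulCoeff]

theorem mulCoeff_inl_inl_ne_zero (hc : c ≠ 0) :
    mulCoeff σ τ a 0 c 0 v (.inl g) (.inl h) ≠ 0 ↔ h = σ * g ∧ v (.inl g) ≠ 0 := by
  simp [mulCoeff, hc]

theorem mulCoeff_inr_inr_ne_zero (ha : a ≠ 0) :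
    mulCoeff σ τ a 0 c 0 v (.inr g) (.inr h) ≠ 0 ↔ h = σ * g ∧ v (.inl g) ≠ 0 := by
  simp [mulCoeff, ha]

theorem isTwoPoint_mulCoeff_of_inl (ha : a ≠ 0) (hc : c ≠ 0) (hg : v (.inl g) ≠ 0)
    (hinl : ∀ h, v (.inl h) ≠ 0 → h = g) (hinr : ∀ h, v (.inr h) = 0) :
    IsTwoPoint (mulCoeff σ τ a 0 c 0 v) (.inl g) (.inr g) (.inl (σ * g)) (.inr (σ * g)) where
  row_ne := Sum.inl_ne_inr
  col_ne := Sum.inl_ne_inr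
  ne_zero₁ := (mulCoeff_inl_inl_ne_zero hc).mpr ⟨rfl, hg⟩
  ne_zero₂ := (mulCoeff_inr_inr_ne_zero ha).mpr ⟨rfl, hg⟩
  eq_zero := by
    rintro (i | i) (j | j) h₁ h₂ <;> by_contra H
    · obtain ⟨rfl, hi⟩ := (mulCoeff_inl_inl_ne_zero hc).mp H
      exact h₁ (by simp [hinl i hi])
    · exact (mulCoeff_inl_inr_ne_zero.mp H).2 (hinr j)
    · exact (mulCoeff_inr_inl_ne_zero.mp H).2 (hinr i)
    · obtain ⟨rfl, hi⟩ := (mulCoeff_inr_inr_ne_zero ha).mp H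
      exact h₂ (by simp [hinl i hi])

theorem isTwoPoint_mulCoeff_of_inr (hinl : ∀ h, v (.inl h) = 0) (hg : v (.inr g) ≠ 0)
    (hinr : ∀ h, v (.inr h) ≠ 0 → h = g) :
    IsTwoPoint (mulCoeff σ τ a b c d v) (.inl (τ * g)) (.inr g) (.inr g) (.inl (τ * g)) where
  row_ne := Sum.inl_ne_inr
  col_ne := Sum.inr_ne_inl
  ne_zero₁ := mulCoeff_inl_inr_ne_zero.mpr ⟨rfl, hg⟩
  ne_zero₂ := mulCoeff_inr_inl_ne_zero.mpr ⟨rfl, hg⟩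
  eq_zero := by
    rintro (i | i) (j | j) h₁ h₂
    · simp [mulCoeff, hinl]
    · by_contra H
      obtain ⟨rfl, hj⟩ := mulCoeff_inl_inr_ne_zero.mp H
      exact h₁ (by simp [hinr j hj])
    · by_contra H
      obtain ⟨rfl, hi⟩ := mulCoeff_inr_inl_ne_zero.mp H
      exact h₂ (by simp [hinr i hi])
    · simp [mulCoeff, hinl]

theorem eq_of_rankLETwo_of_inr (hv : ∀ g, v (.inl g) = 0)
    (hM : RankLETwo (mulCoeff σ τ a b c d v)) (hg : v (.inr g) ≠ 0)
    (hh : v (.inr h) ≠ 0) : h = g := by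
  by_contra hne
  have := hM.ne_zero_or_ne_zero (r₁ := .inl (τ * g)) (r₂ := .inr g) (i := .inl (τ * h))
    (s₁ := .inr g) (s₂ := .inl (τ * g)) (j := .inr h)
  simp [mulCoeff, hv, hg, hh, hne] at this

variable [IsMulCommutative Gal(L/K)]

theorem IsGenericPair.symm (hστ : IsGenericPair σ τ) : IsGenericPair τ σ where
  ne := hστ.ne.symm
  mul_ne_one := mul_comm' σ τ ▸ hστ.mul_ne_one
  left_eq_one := hστ.right_eq_one
  right_eq_one := hστ.left_eq_one

theorem ne_zero_or_ne_zero_of_inl (hστ : IsGenericPair σ τ) (hσ : σ = 1 → b = 0 ∧ d = 0)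
    (ha : a ≠ 0) (hc : c ≠ 0) (hM : RankLETwo (mulCoeff σ τ a b c d v)) (hg : v (.inl g) ≠ 0)
    {i j : Gal(L/K) ⊕ Gal(L/K)} (hij : mulCoeff σ τ a b c d v i j ≠ 0) :
    mulCoeff σ τ a b c d v i (.inl (σ * g)) ≠ 0 ∧ mulCoeff σ τ a b c d v (.inl g) j ≠ 0 ∨
      mulCoeff σ τ a b c d v i (.inr (σ * g)) ≠ 0 ∧ mulCoeff σ τ a b c d v (.inr g) j ≠ 0 := by
  have hσσ (h : σ * σ = 1) : b = 0 ∧ d = 0 := hσ (hστ.left_eq_one h)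
  refine hM.ne_zero_or_ne_zero ?_ ?_ ?_ ?_ hij
  · simp [mulCoeff, ← mul_assoc, hστ.symm.mul_ne_one]
  · simp [mulCoeff, hστ.ne]
  · by_cases h : σ * σ = 1 <;> simp [mulCoeff, ← mul_assoc, h, hσσ, hg, hc]
  · by_cases h : σ * σ = 1 <;> simp [mulCoeff, ← mul_assoc, h, hσσ, hg, ha]

theorem eq_zero_of_rankLETwo (hστ : IsGenericPair σ τ) (hσ : σ = 1 → b = 0 ∧ d = 0) (hτ : τ ≠ 1)
    (ha : a ≠ 0) (hc : c ≠ 0) (hM : RankLETwo (mulCoeff σ τ a b c d v)) (hg : v (.inl g) ≠ 0) :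
    b = 0 ∧ d = 0 := by
  by_cases hσ₁ : σ = 1
  · exact hσ hσ₁
  have hσσ : σ * σ ≠ 1 := fun h => hσ₁ (hστ.left_eq_one h)
  have pivot {i j} := ne_zero_or_ne_zero_of_inl hστ hσ ha hc hM hg (i := i) (j := j)
  constructor
  · have := pivot (i := .inr (σ * g)) (j := .inr g)
    simpa [mulCoeff, ← mul_assoc, hσ₁, hσσ, hτ, hg] using this
  · have := pivot (i := .inl (σ * g)) (j := .inl g)
    simpa [mulCoeff, ← mul_assoc, hστ.ne.symm, hσ₁, hσσ, hτ, hg] using this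

theorem eq_of_rankLETwo_of_inl (hστ : IsGenericPair σ τ) (ha : a ≠ 0) (hc : c ≠ 0)
    (hM : RankLETwo (mulCoeff σ τ a 0 c 0 v)) (hg : v (.inl g) ≠ 0) (hh : v (.inl h) ≠ 0) :
    h = g := by
  have pivot {i j} := ne_zero_or_ne_zero_of_inl hστ (fun _ => ⟨rfl, rfl⟩) ha hc hM hg
    (i := i) (j := j)
  by_contra hne
  obtain ⟨hh_eq, hσh⟩ : h = τ * (σ * g) ∧ σ * h = τ * g := by
    rcases pivot ((mulCoeff_inl_inl_ne_zero hc).mpr ⟨rfl, hh⟩) with H | H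
    · exact absurd (mul_left_cancel ((mulCoeff_inl_inl_ne_zero hc).mp H.1).1).symm hne
    · exact ⟨(mulCoeff_inl_inr_ne_zero.mp H.1).1, (mulCoeff_inr_inl_ne_zero.mp H.2).1⟩
  have hg_eq : g = τ * (σ * h) := by
    rcases pivot ((mulCoeff_inr_inr_ne_zero ha).mpr ⟨rfl, hh⟩) with H | H
    · exact (mulCoeff_inl_inr_ne_zero.mp H.2).1
    · exact absurd (mul_left_cancel ((mulCoeff_inr_inr_ne_zero ha).mp H.1).1).symm hne
  have hττ : τ * τ = 1 := by
    rw [hσh, ← mul_assoc] at hg_eq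
    exact mul_eq_right.mp hg_eq.symm
  have hσσ : σ * σ = 1 := by
    rw [hh_eq, ← mul_assoc, ← mul_assoc, mul_left_inj, mul_comm' σ τ, mul_assoc] at hσh
    exact mul_eq_left.mp hσh
  exact hστ.ne ((hστ.left_eq_one hσσ).trans (hστ.right_eq_one hττ).symm)

theorem inr_eq_zero_of_rankLETwo (hστ : IsGenericPair σ τ) (hτ : τ ≠ 1) (ha : a ≠ 0)
    (hc : c ≠ 0) (hM : RankLETwo (mulCoeff σ τ a 0 c 0 v)) (hg : v (.inl g) ≠ 0) :
    v (.inr h) = 0 := by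
  have hv {k} (hk : k ≠ g) : v (.inl k) = 0 :=
    not_not.mp fun hk' => hk (eq_of_rankLETwo_of_inl hστ ha hc hM hg hk')
  have pivot {i j} := ne_zero_or_ne_zero_of_inl hστ (fun _ => ⟨rfl, rfl⟩) ha hc hM hg
    (i := i) (j := j)
  by_contra hh
  have h₁ : σ * g = τ * h ∨ h = g :=
    (pivot (mulCoeff_inr_inl_ne_zero.mpr ⟨rfl, hh⟩)).imp
      (fun H => (mulCoeff_inr_inl_ne_zero.mp H.1).1)
      fun H => mul_left_cancel (mulCoeff_inr_inl_ne_zero.mp H.2).1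
  have h₂ : g = τ * h ∨ h = σ * g :=
    (pivot (mulCoeff_inl_inr_ne_zero.mpr ⟨rfl, hh⟩)).imp
      (fun H => (mulCoeff_inl_inr_ne_zero.mp H.2).1)
      fun H => ((mulCoeff_inr_inr_ne_zero ha).mp H.2).1
  obtain ⟨rfl, h₃⟩ : σ = 1 ∧ (g = τ * h ∨ h = g) := by
    rcases h₁ with h₁ | h₁ <;> rcases h₂ with h₂ | h₂
    · exact ⟨mul_eq_right.mp (h₁.trans h₂.symm), .inl h₂⟩
    · exact absurd (mul_eq_right.mp (h₁.symm.trans h₂.symm)) hτ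
    · exact absurd (mul_eq_right.mp (h₂.symm.trans h₁.symm)) hτ
    · exact ⟨mul_eq_right.mp (h₂.symm.trans h₁), .inr h₁⟩
  rcases h₃ with rfl | rfl
  · have := hM.ne_zero_or_ne_zero (r₁ := .inl (τ * h)) (s₁ := .inr h) (r₂ := .inr (τ * h))
      (s₂ := .inr (τ * h)) (i := .inr h) (j := .inl (τ * h))
    simp [mulCoeff, hτ, ha, hg, hh, hv] at this
  · have := hM.ne_zero_or_ne_zero (r₁ := .inl h) (s₁ := .inl h) (r₂ := .inl (τ * h))
      (s₂ := .inr h) (i := .inr h) (j := .inl (τ * h))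
    simp [mulCoeff, hτ, hc, hg, hh, hv] at this

theorem isTwoPoint_of_rankLETwo (hστ : IsGenericPair σ τ) (hσ : σ = 1 → b = 0 ∧ d = 0)
    (hτ : τ ≠ 1) (ha : a ≠ 0) (hc : c ≠ 0) (hv : v ≠ 0)
    (hM : RankLETwo (mulCoeff σ τ a b c d v)) :
    (b = 0 ∧ ∃ g, IsTwoPoint (mulCoeff σ τ a b c d v)
        (.inl g) (.inr g) (.inl (σ * g)) (.inr (σ * g))) ∨
      ∃ g, IsTwoPoint (mulCoeff σ τ a b c d v) (.inl (τ * g)) (.inr g) (.inr g) (.inl (τ * g)) := by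
  by_cases hinl : ∃ g, v (.inl g) ≠ 0
  · obtain ⟨g, hg⟩ := hinl
    obtain ⟨rfl, rfl⟩ := eq_zero_of_rankLETwo hστ hσ hτ ha hc hM hg
    exact .inl ⟨rfl, g, isTwoPoint_mulCoeff_of_inl ha hc hg
      (fun _ => eq_of_rankLETwo_of_inl hστ ha hc hM hg)
      fun _ => inr_eq_zero_of_rankLETwo hστ hτ ha hc hM hg⟩
  · push Not at hinl
    obtain ⟨g | g, hg⟩ := Function.ne_iff.mp hv
    · exact absurd (hinl g) hg
    · exact .inr ⟨g, isTwoPoint_mulCoeff_of_inr hinl hg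
        fun _ => eq_of_rankLETwo_of_inr hinl hM hg⟩

end Classification

section Homotopy

variable {K L : Type*} [Field K] [Field L] [Algebra K L] {σ τ : Gal(L/K)}
  {a b c d a' b' c' d' : L} {u₀ u₁ v₀ v₁ w₀ w₁ : Gal(L/K) ⊕ Gal(L/K) → L}

theorem exists_eq_linearForm_prod [FiniteDimensional K L] [IsGalois K L]
    (f : L × L →ₗ[K] L × L) :
    ∃ v₀ v₁ : Gal(L/K) ⊕ Gal(L/K) → L, ∀ x, f x = (linearForm v₀ x, linearForm v₁ x) := by
  obtain ⟨v₀, h₀⟩ := linearForm_surjective (LinearMap.fst K L L ∘ₗ f)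
  obtain ⟨v₁, h₁⟩ := linearForm_surjective (LinearMap.snd K L L ∘ₗ f)
  exact ⟨v₀, v₁, fun x => by rw [h₀, h₁]; rfl⟩

theorem mulCoeff_eq_of_fst [FiniteDimensional K L] [IsMulCommutative Gal(L/K)]
    (h : ∀ x y, linearForm v₀ (twistedMul σ τ a b c d x y) =
      (twistedMul τ σ a' b' c' d' (linearForm u₀ x, linearForm u₁ x)
        (linearForm w₀ y, linearForm w₁ y)).1) (i j : Gal(L/K) ⊕ Gal(L/K)) :
    mulCoeff σ τ a b c d v₀ i j = a' * (u₁ i * twist τ w₁ j) + b' * (twist τ u₁ i * w₁ j) +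
      (c' * (u₀ i * twist τ w₀ j) + d' * (twist τ u₀ i * w₀ j)) := by
  revert i j
  simp only [← funext_iff]
  refine bilinearForm_injective (funext₂ fun x y => ?_)
  rw [bilinearForm_mulCoeff, h]
  simp only [twistedMul, ← linearForm_twist]
  simp only [linearForm_apply, bilinearForm_apply, Finset.sum_mul_sum]
  simp only [Finset.mul_sum, ← Finset.sum_add_distrib]
  exact Finset.sum_congr rfl fun i _ => Finset.sum_congr rfl fun j _ => by ring

theorem mulCoeff_eq_of_snd [FiniteDimensional K L] [IsMulCommutative Gal(L/K)]
    (h : ∀ x y, linearForm v₁ (twistedMul σ τ a b c d x y) =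
      (twistedMul τ σ a' b' c' d' (linearForm u₀ x, linearForm u₁ x)
        (linearForm w₀ y, linearForm w₁ y)).2) (i j : Gal(L/K) ⊕ Gal(L/K)) :
    mulCoeff σ τ a b c d v₁ i j = twist σ u₀ i * w₁ j + u₁ i * twist σ w₀ j := by
  revert i j
  simp only [← funext_iff]
  refine bilinearForm_injective (funext₂ fun x y => ?_)
  rw [bilinearForm_mulCoeff, h]
  simp only [twistedMul, ← linearForm_twist]
  simp only [linearForm_apply, bilinearForm_apply, Finset.sum_mul_sum, ← Finset.sum_add_distrib]
  exact Finset.sum_congr rfl fun i _ => Finset.sum_congr rfl fun j _ => by ring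

theorem eq_zero_of_twist_smul_eq_zero {g : Gal(L/K)} {v : Gal(L/K) ⊕ Gal(L/K) → L}
    {i : Gal(L/K) ⊕ Gal(L/K)} (h : twist g v (g • i) = 0) : v i = 0 := by
  rwa [twist_smul, map_eq_zero] at h

variable (h₀ : ∀ i j, mulCoeff σ τ a b c d v₀ i j =
    a' * (u₁ i * twist τ w₁ j) + b' * (twist τ u₁ i * w₁ j) +
      (c' * (u₀ i * twist τ w₀ j) + d' * (twist τ u₀ i * w₀ j)))
  (h₁ : ∀ i j, mulCoeff σ τ a b c d v₁ i j = twist σ u₀ i * w₁ j + u₁ i * twist σ w₀ j)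
include h₀ h₁

theorem row_eq_zero_of_isTwoPoint {i r₁ r₂ s₁ s₂ : Gal(L/K) ⊕ Gal(L/K)}
    (hv₁ : IsTwoPoint (mulCoeff σ τ a b c d v₁) r₁ r₂ s₁ s₂) (ha' : a' ≠ 0) (hc' : c' ≠ 0)
    (hi : σ = 1 ∨ u₀ i = 0)
    (hzero : ∀ j, j = s₁ ∨ j = s₂ → mulCoeff σ τ a b c d v₀ i (τ • j) = 0)
    (hτ : ∀ j, j = s₁ ∨ j = s₂ → τ • j ≠ s₁ ∧ τ • j ≠ s₂)
    (hστ : ∀ j, j = s₁ ∨ j = s₂ → σ • τ • j ≠ s₁ ∧ σ • τ • j ≠ s₂) :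
    u₀ i = 0 ∧ u₁ i = 0 := by
  have hdet : τ (w₁ s₁) * τ (twist σ w₀ s₂) - τ (w₁ s₂) * τ (twist σ w₀ s₁) ≠ 0 := by
    rw [← map_mul, ← map_mul, ← map_sub, map_ne_zero]
    exact hv₁.col_det_ne_zero h₁
  -- In the columns `τ • s₁` and `τ • s₂` the terms with `b'` and `d'` vanish, which leaves a linear
  -- system in `u₁ i` and `u₀ i` with nonzero determinant.
  have hcomb (j) (hj : j = s₁ ∨ j = s₂) :
      a' * u₁ i * τ (w₁ j) + c' * u₀ i * τ (twist σ w₀ j) = 0 := by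
    have hw₁ : w₁ (τ • j) = 0 := (hv₁.col_eq_zero h₁ (hτ j hj).1 (hτ j hj).2).1
    have hw₀ : w₀ (τ • j) = 0 := eq_zero_of_twist_smul_eq_zero
      (hv₁.col_eq_zero h₁ (hστ j hj).1 (hστ j hj).2).2
    have hu₀ : u₀ i * τ (w₀ j) = u₀ i * τ (twist σ w₀ j) := by
      rcases hi with rfl | hi
      · rw [twist_one]
      · simp [hi]
    have h := h₀ i (τ • j)
    rw [hzero j hj, hw₁, hw₀, twist_smul, twist_smul] at h
    linear_combination -h - c' * hu₀
  have hu := eq_zero_of_det_ne_zero hdet (hcomb s₁ (.inl rfl)) (hcomb s₂ (.inr rfl))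
  exact ⟨(mul_eq_zero.mp hu.2).resolve_left hc', (mul_eq_zero.mp hu.1).resolve_left ha'⟩

theorem not_isTwoPoint_inl_of_eq_one (hgen : IsGenericPair σ τ) (hσ : σ = 1) (hτ : τ ≠ 1)
    (ha' : a' ≠ 0) (hc' : c' ≠ 0) (g : Gal(L/K)) :
    ¬ IsTwoPoint (mulCoeff σ τ a b c d v₁) (.inl g) (.inr g) (.inl (σ * g)) (.inr (σ * g)) := by
  intro hv₁
  have hττ : τ * τ ≠ 1 := fun h => hτ (hgen.right_eq_one h)
  have hu := row_eq_zero_of_isTwoPoint h₀ h₁ hv₁ ha' hc' (i := .inl g) (.inl hσ)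
    (by rintro _ (rfl | rfl) <;> simp [mulCoeff, ← mul_assoc, hσ, hτ, hττ])
    (by rintro _ (rfl | rfl) <;> simp [hτ])
    (by rintro _ (rfl | rfl) <;> simp [hσ, hτ])
  apply hv₁.row_det_ne_zero h₁
  rw [hσ, twist_one, hu.1, hu.2]
  ring

theorem not_isTwoPoint_inr (hgen : IsGenericPair σ τ) (hτ : τ ≠ 1) (ha' : a' ≠ 0)
    (hc' : c' ≠ 0) (g : Gal(L/K)) :
    ¬ IsTwoPoint (mulCoeff σ τ a b c d v₁) (.inl (τ * g)) (.inr g) (.inr g) (.inl (τ * g)) := by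
  intro hv₁
  have hu {i} (hi : i = .inl (τ * g) ∨ i = .inr g) : u₁ i = 0 := by
    refine (row_eq_zero_of_isTwoPoint h₀ h₁ hv₁ ha' hc' (i := i) ?_ ?_ ?_ ?_).2
    · refine or_iff_not_imp_left.mpr fun hσ => eq_zero_of_twist_smul_eq_zero (g := σ)
        (hv₁.row_eq_zero h₁ ?_ ?_).1 <;> rcases hi with rfl | rfl <;> simp [hσ]
    · rcases hi with rfl | rfl <;> rintro _ (rfl | rfl) <;>
        simp [mulCoeff, ← mul_assoc, hτ, hgen.ne.symm, hgen.mul_ne_one]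
    · rintro _ (rfl | rfl) <;> simp [hτ]
    · rintro _ (rfl | rfl) <;> simp [← mul_assoc, hgen.mul_ne_one]
  apply hv₁.row_det_ne_zero h₁
  rw [hu (.inl rfl), hu (.inr rfl)]
  ring

theorem twist_inr_eq_zero_of_isTwoPoint_inl (hστ : σ ≠ τ) (hσ : σ ≠ 1) (hτ : τ ≠ 1)
    (hc' : c' ≠ 0) (hb : b = 0) {g : Gal(L/K)}
    (hv₁ : IsTwoPoint (mulCoeff σ τ a b c d v₁) (.inl g) (.inr g) (.inl (σ * g)) (.inr (σ * g))) :
    twist σ u₀ (.inr g) = 0 := by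
  have hu₁ : u₁ (.inr (σ⁻¹ * g)) = 0 := (hv₁.row_eq_zero h₁ (by simp) (by simp [hσ])).2
  have hmul {j} (hj : j = .inl g ∨ j = .inr g) : u₀ (.inr (σ⁻¹ * g)) * τ (w₀ j) = 0 := by
    have hw₁ : w₁ (τ • j) = 0 := by
      refine (hv₁.col_eq_zero h₁ ?_ ?_).1 <;> rcases hj with rfl | rfl <;> simp [hστ.symm]
    have hw₀ : w₀ (τ • j) = 0 := by
      refine eq_zero_of_twist_smul_eq_zero (g := σ) (hv₁.col_eq_zero h₁ ?_ ?_).2 <;>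
        rcases hj with rfl | rfl <;> simp [hτ]
    have hM : mulCoeff σ τ a b c d v₀ (.inr (σ⁻¹ * g)) (τ • j) = 0 := by
      rcases hj with rfl | rfl <;> simp [mulCoeff, hb, hσ, hτ]
    have h := h₀ (.inr (σ⁻¹ * g)) (τ • j)
    rw [hM, hu₁, hw₁, hw₀, twist_smul, twist_smul] at h
    exact (mul_eq_zero.mp (by linear_combination -h :
      c' * (u₀ (.inr (σ⁻¹ * g)) * τ (w₀ j)) = 0)).resolve_left hc'
  by_contra hne
  have hu₀ : u₀ (.inr (σ⁻¹ * g)) ≠ 0 := fun h => hne (by simp [twist, h])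
  have hw₀ {j} (hj : j = .inl g ∨ j = .inr g) : twist σ w₀ (σ • j) = 0 := by
    simpa [hu₀] using hmul hj
  apply hv₁.col_det_ne_zero h₁
  rw [show twist σ w₀ (.inl (σ * g)) = 0 from hw₀ (.inl rfl),
    show twist σ w₀ (.inr (σ * g)) = 0 from hw₀ (.inr rfl)]
  ring

theorem not_isTwoPoint_inl_of_ne_one [IsMulCommutative Gal(L/K)] (hgen : IsGenericPair σ τ)
    (hσ : σ ≠ 1) (hτ : τ ≠ 1) (ha' : a' ≠ 0) (hc' : c' ≠ 0) (hb : b = 0) (g : Gal(L/K)) :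
    ¬ IsTwoPoint (mulCoeff σ τ a b c d v₁) (.inl g) (.inr g) (.inl (σ * g)) (.inr (σ * g)) := by
  intro hv₁
  have hu₁ : u₁ (.inr g) = 0 := by
    refine (row_eq_zero_of_isTwoPoint h₀ h₁ hv₁ ha' hc' (i := .inr g) (.inr ?_) ?_ ?_ ?_).2
    · exact eq_zero_of_twist_smul_eq_zero (g := σ)
        (hv₁.row_eq_zero h₁ (by simp) (by simp [hσ])).1
    · rintro _ (rfl | rfl) <;> simp [mulCoeff, ← mul_assoc, hb, hσ, hτ]
    · rintro _ (rfl | rfl) <;> simp [hτ]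
    · rintro _ (rfl | rfl) <;> simp [← mul_assoc, hgen.mul_ne_one]
  apply hv₁.row_det_ne_zero h₁
  rw [hu₁, twist_inr_eq_zero_of_isTwoPoint_inl h₀ h₁ hgen.ne hσ hτ hc' hb hv₁]
  ring

end Homotopy

section Isotopy

variable {K L : Type*} [Field K] [Field L] [Algebra K L] {σ τ : Gal(L/K)}
  {a b c d a' b' c' d' : L}

theorem twistedMul_one_left (τ : Gal(L/K)) (a b c d : L) :
    twistedMul 1 τ a b c d = twistedMul 1 τ (a + b) 0 (c + d) 0 := by
  funext x y
  simp only [twistedMul, AlgEquiv.one_apply]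
  congr 1
  ring

theorem add_ne_zero_of_twistedMul_noZeroDivisors
    (h : ∀ x y, twistedMul σ τ a b c d x y = 0 → x = 0 ∨ y = 0) : a + b ≠ 0 ∧ c + d ≠ 0 := by
  refine ⟨fun hab => ?_, fun hcd => ?_⟩
  · simpa using h (0, 1) (0, 1) (by simp [twistedMul, hab])
  · simpa using h (1, 0) (1, 0) (by simp [twistedMul, hcd])

theorem ne_zero_of_twistedMul_noZeroDivisors {α η θ : L}
    (h : ∀ x y, twistedMul σ τ 1 (-η) α (-(α * θ)) x y = 0 → x = 0 ∨ y = 0) : α ≠ 0 := by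
  rintro rfl
  simpa using (add_ne_zero_of_twistedMul_noZeroDivisors h).2

section FiniteDimensional

variable [FiniteDimensional K L] [IsAbelianGalois K L]

theorem not_homotopy_of_ne_one (hgen : IsGenericPair σ τ) (hσ : σ = 1 → b = 0 ∧ d = 0)
    (hτ : τ ≠ 1) (ha : a ≠ 0) (hc : c ≠ 0) (ha' : a' ≠ 0) (hc' : c' ≠ 0)
    {f : L × L →ₗ[K] L × L} (hf : LinearMap.snd K L L ∘ₗ f ≠ 0) (p q : L × L →ₗ[K] L × L) :
    ¬ ∀ x y, f (twistedMul σ τ a b c d x y) = twistedMul τ σ a' b' c' d' (p x) (q y) := by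
  intro hfpq
  obtain ⟨v₀, v₁, hv⟩ := exists_eq_linearForm_prod f
  obtain ⟨u₀, u₁, hu⟩ := exists_eq_linearForm_prod p
  obtain ⟨w₀, w₁, hw⟩ := exists_eq_linearForm_prod q
  simp only [hv, hu, hw, Prod.ext_iff, forall_and] at hfpq
  have h₀ := mulCoeff_eq_of_fst hfpq.1
  have h₁ := mulCoeff_eq_of_snd hfpq.2
  have hv₁ : v₁ ≠ 0 := by
    rintro rfl
    exact hf (LinearMap.ext fun x => by simp [hv])
  rcases isTwoPoint_of_rankLETwo hgen hσ hτ ha hc hv₁ ⟨_, _, _, _, h₁⟩ with ⟨hb, g, hg⟩ | ⟨g, hg⟩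
  · by_cases hσ₁ : σ = 1
    · exact not_isTwoPoint_inl_of_eq_one h₀ h₁ hgen hσ₁ hτ ha' hc' g hg
    · exact not_isTwoPoint_inl_of_ne_one h₀ h₁ hgen hσ₁ hτ ha' hc' hb g hg
  · exact not_isTwoPoint_inr h₀ h₁ hgen hτ ha' hc' g hg

theorem not_isotopism_of_ne_one (hgen : IsGenericPair σ τ) (hτ : τ ≠ 1) (ha : a ≠ 0)
    (hc : c ≠ 0) (ha' : a' ≠ 0) (hc' : c' ≠ 0)
    (h : ∀ x y, twistedMul σ τ a b c d x y = 0 → x = 0 ∨ y = 0) :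
    ¬ ∃ N₁ N₂ N₃ : (L × L) ≃ₗ[K] L × L, ∀ x y,
      N₁ (twistedMul σ τ a b c d x y) = twistedMul τ σ a' b' c' d' (N₂ x) (N₃ y) := by
  rintro ⟨N₁, N₂, N₃, hN⟩
  have hN₁ : LinearMap.snd K L L ∘ₗ N₁.toLinearMap ≠ 0 := fun h₀ => by
    simpa using LinearMap.congr_fun h₀ (N₁.symm (0, 1))
  by_cases hσ : σ = 1
  · subst hσ
    have hsum := add_ne_zero_of_twistedMul_noZeroDivisors h
    rw [twistedMul_one_left] at hN
    exact not_homotopy_of_ne_one hgen (fun _ => ⟨rfl, rfl⟩) hτ hsum.1 hsum.2 ha' hc' hN₁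
      N₂.toLinearMap N₃.toLinearMap hN
  · exact not_homotopy_of_ne_one hgen (absurd · hσ) hτ ha hc ha' hc' hN₁
      N₂.toLinearMap N₃.toLinearMap hN

theorem mainTheorem12_general (hgen : IsGenericPair σ τ) {α₁ η₁ θ₁ α₂ η₂ θ₂ : L}
    (h : ∀ x y, twistedMul σ τ 1 (-η₁) α₁ (-(α₁ * θ₁)) x y = 0 → x = 0 ∨ y = 0) :
    ¬ ∃ N₁ N₂ N₃ : (L × L) ≃ₗ[K] L × L, ∀ x y,
      N₁ (twistedMul σ τ 1 (-η₁) α₁ (-(α₁ * θ₁)) x y) =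
        twistedMul τ σ 1 (-η₂) α₂ (-(α₂ * θ₂)) (N₂ x) (N₃ y) := by
  rintro ⟨N₁, N₂, N₃, hN⟩
  have h' x y (hxy : twistedMul τ σ 1 (-η₂) α₂ (-(α₂ * θ₂)) x y = 0) : x = 0 ∨ y = 0 := by
    simpa using h (N₂.symm x) (N₃.symm y) (N₁.injective (by simpa [hN] using hxy))
  have hα₁ := ne_zero_of_twistedMul_noZeroDivisors h
  have hα₂ := ne_zero_of_twistedMul_noZeroDivisors h'
  by_cases hτ : τ = 1
  · have hσ : σ ≠ 1 := fun hσ => hgen.ne (hσ.trans hτ.symm)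
    have hN' x y : N₁.symm (twistedMul τ σ 1 (-η₂) α₂ (-(α₂ * θ₂)) x y) =
        twistedMul σ τ 1 (-η₁) α₁ (-(α₁ * θ₁)) (N₂.symm x) (N₃.symm y) := by
      simp [LinearEquiv.symm_apply_eq, hN]
    exact not_isotopism_of_ne_one hgen.symm hσ one_ne_zero hα₂ one_ne_zero hα₁ h'
      ⟨N₁.symm, N₂.symm, N₃.symm, hN'⟩
  · exact not_isotopism_of_ne_one hgen hτ one_ne_zero hα₁ one_ne_zero hα₂ h
      ⟨N₁, N₂, N₃, hN⟩

end FiniteDimensional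

end Isotopy

section Frobenius

theorem isGenericPair_pow {G : Type*} [Group G] {g : G} {k l : ℕ} (hk : 2 * k < orderOf g)
    (hl : 2 * l < orderOf g) (hkl : k ≠ l) : IsGenericPair (g ^ k) (g ^ l) := by
  have pow_eq_one {n : ℕ} (hn : n < orderOf g) (h : g ^ n = 1) : n = 0 :=
    not_not.mp fun hn₀ => pow_ne_one_of_lt_orderOf hn₀ hn h
  have pow_eq_one_of_sq {n : ℕ} (hn : 2 * n < orderOf g) (h : g ^ n * g ^ n = 1) : g ^ n = 1 := by
    rw [← pow_add] at h
    have := pow_eq_one (by lia) h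
    rw [show n = 0 by lia, pow_zero]
  refine ⟨fun h => hkl ?_, fun h => hkl ?_, pow_eq_one_of_sq hk, pow_eq_one_of_sq hl⟩
  · exact pow_injOn_Iio_orderOf (Set.mem_Iio.mpr (by lia)) (Set.mem_Iio.mpr (by lia)) h
  · rw [← pow_add] at h
    have := pow_eq_one (by lia) h
    lia

variable {p : ℕ} [Fact p.Prime] {L : Type*} [Field L] [Algebra (ZMod p) L]

theorem mulS_eq_twistedMul (σ τ : L ≃ₐ[ZMod p] L) (α η : L) :
    mulS σ τ α η = twistedMul σ τ 1 (-η) α (-(α * η)) := by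
  funext x y
  simp only [mulS, twistedMul]
  congr 1
  ring

theorem mulS'_eq_twistedMul (σ τ : L ≃ₐ[ZMod p] L) (α η : L) :
    mulS' σ τ α η = twistedMul σ τ 1 (-η) α (-(α * τ.symm η)) := by
  funext x y
  simp only [mulS', twistedMul]
  congr 1
  ring

theorem isGenericPair_of_forall_eq_pow [Finite L] {m k l : ℕ}
    (hL : Nat.card L = p ^ m) {σ τ : L ≃ₐ[ZMod p] L} (hσ : ∀ x, σ x = x ^ p ^ k)
    (hτ : ∀ x, τ x = x ^ p ^ l) (hk : 2 * k < m) (hl : 2 * l < m) (hkl : k ≠ l) :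
    IsGenericPair σ τ := by
  set φ := FiniteField.frobeniusAlgEquivOfAlgebraic (ZMod p) L
  have orderOf_φ : orderOf φ = m := by
    rw [FiniteField.orderOf_frobeniusAlgEquivOfAlgebraic]
    refine Nat.pow_right_injective (Fact.out : p.Prime).two_le ?_
    simpa [hL] using (Module.natCard_eq_pow_finrank (K := ZMod p) (V := L)).symm
  have eq_φ_pow {n : ℕ} {ψ : L ≃ₐ[ZMod p] L} (hψ : ∀ x, ψ x = x ^ p ^ n) : ψ = φ ^ n := by
    ext x
    simp [φ, hψ, AlgEquiv.coe_pow, FiniteField.coe_frobeniusAlgEquivOfAlgebraic_iterate]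
  rw [eq_φ_pow hσ, eq_φ_pow hτ]
  exact isGenericPair_pow (by lia) (by lia) hkl

end Frobenius

theorem mainTheorem12 (p m k l : ℕ) [Fact p.Prime] {L : Type*} [Field L] [Algebra (ZMod p) L]
    (hL : Nat.card L = p ^ m) (σ τ : L ≃ₐ[ZMod p] L)
    (hσ : ∀ x, σ x = x ^ p ^ k) (hτ : ∀ x, τ x = x ^ p ^ l)
    (hk : 2 * k < m) (hl : 2 * l < m) (hkl : k ≠ l) (α₁ η₁ α₂ η₂ : L) :
    (IsPresemifield (mulS σ τ α₁ η₁) → IsPresemifield (mulS τ σ α₂ η₂) →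
      ¬ Isotopic p (mulS σ τ α₁ η₁) (mulS τ σ α₂ η₂)) ∧
    (IsPresemifield (mulS' σ τ α₁ η₁) → IsPresemifield (mulS' τ σ α₂ η₂) →
      ¬ Isotopic p (mulS' σ τ α₁ η₁) (mulS' τ σ α₂ η₂)) := by
  have : Finite L := Nat.finite_of_card_ne_zero
    (hL ▸ pow_ne_zero m (Fact.out : p.Prime).ne_zero)
  have : IsAbelianGalois (ZMod p) L := IsAbelianGalois.of_isCyclic (ZMod p) L
  have hgen := isGenericPair_of_forall_eq_pow hL hσ hτ hk hl hkl
  simp only [mulS_eq_twistedMul, mulS'_eq_twistedMul]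
  exact ⟨fun h _ => mainTheorem12_general hgen h.eq_zero_or_eq_zero,
    fun h _ => mainTheorem12_general hgen h.eq_zero_or_eq_zero⟩
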